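/- Let $H$ be a complex Hilbert space with an orthonormal basis $\{E_k\}_{k\ge 0}$, let $U$ be the unilateral shift $UE_k=E_{k+1}$, and let $\mathcal{T}=C^*(U)\subseteq B(H)$ be the Toeplitz algebra. Identify $H$ with the closed subspace of $L^2(\mathbb{R}/\mathbb{Z})$ spanned by the functions $e^{2\pi i kx}$, $k\ge 0$ (so that $E_k$ corresponds to $e^{2\pi i kx}$), let $P$ be the orthogonal projection onto it, and for $f\in C(\mathbb{R}/\mathbb{Z})$ let $T(f)\varphi=P(f\varphi)$, $\varphi\in H$, be the Toeplitz operator. Let $P_{k,l}$ be the matrix units, $P_{k,l}E_j=\delta_{j,l}E_k$, let $\mathcal{K}^\infty$ be the set of operators $\sum_{k,l\ge0}c_{k,l}P_{k,l}$ with rapidly decaying coefficients (i.e. $\sup_{k,l}(1+k+l)^N|c_{k,l}|<\infty$ for all $N$), and let $$\mathcal{T}^\infty=\{T(f)+c:\ f\in C^\infty(\mathbb{R}/\mathbb{Z}),\ c\in\mathcal{K}^\infty\}\subseteq\mathcal{T}.$$ Let $S_{\mathcal{E}}=\{\sum_k x_kE_k:\ \sup_k(1+k)^N|x_k|<\infty\text{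 for all }N\}$, a Fréchet space with the norms $\|x\|_N=\big(\sum_k(1+k)^{2N}|x_k|^2\big)^{1/2}$, $N\ge0$. Theorem. Let $g=\begin{bmatrix}\alpha&\beta\\ \bar\beta&\bar\alpha\end{bmatrix}\in SU(1,1)$, that is, $|\alpha|^2-|\beta|^2=1$. Then $\bar\beta U+\bar\alpha$ is invertible in $\mathcal{T}$ and, with $$W_g=(\alpha U+\beta)(\bar\beta U+\bar\alpha)^{-1},$$ there is a unique $*$-automorphism $\rho_g$ of $\mathcal{T}$ with $\rho_g(U)=W_g$. It satisfies $$\rho_g(\mathcal{T}^\infty)\subseteq\mathcal{T}^\infty.$$ Moreover, the series $F_0=\sum_{k\ge0}\frac{(-\bar\beta)^k}{\bar\alpha^{\,k+1}}E_k$ converges in $H$, there is a unitary operator $\mathcal{U}_g$ on $H$ with $\mathcal{U}_gE_k=W_g^kF_0$ for all $k\ge0$, it implements $\rho_g$, i.e. $\rho_g(a)=\mathcal{U}_g\,a\,\mathcal{U}_g^{-1}$ for all $a\in\mathcal{T}$, and it maps $S_{\mathcal{E}}$ into itself continuously with respect to the Fréchet topology of $S_{\mathcal{E}}$. -/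

import Mathlib

noncomputable section

namespace SmoothToeplitz

open MeasureTheory

/-- The group `SU(1,1)`: complex matrices `!![α, β; conj β, conj α]` with `|α|² - |β|² = 1`. -/
def SU11 : Set (Matrix (Fin 2) (Fin 2) ℂ) :=
  {g | ∃ α β : ℂ, g = !![α, β; star β, star α] ∧ ‖α‖ ^ 2 - ‖β‖ ^ 2 = 1}

variable {H : Type*} [NormedAddCommGroup H] [InnerProductSpace ℂ H] [CompleteSpace H]

/-- The linear isometry that sends the basis vector `E k` to `v k`, for an orthonormal
sequence `v`. -/
def basisIsometry {F : Type*} [NormedAddCommGroup F] [InnerProductSpace ℂ F] [CompleteSpace F]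
    (E : HilbertBasis ℕ ℂ H) {v : ℕ → F} (hv : Orthonormal ℂ v) : H →ₗᵢ[ℂ] F :=
  (hv.orthogonalFamily.linearIsometry).comp E.repr.toLinearIsometry

theorem basisIsometry_apply {F : Type*} [NormedAddCommGroup F] [InnerProductSpace ℂ F]
    [CompleteSpace F] (E : HilbertBasis ℕ ℂ H) {v : ℕ → F} (hv : Orthonormal ℂ v) (k : ℕ) :
    basisIsometry E hv (E k) = v k := by
  have h : E.repr (E k) = lp.single 2 k (1 : ℂ) := E.repr_self k
  change hv.orthogonalFamily.linearIsometry (E.repr (E k)) = v k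
  rw [h, OrthogonalFamily.linearIsometry_apply_single]
  simp

/-! ### The Toeplitz algebra -/

/-- The unilateral shift `U`, with `U (E k) = E (k + 1)`. -/
def shift (E : HilbertBasis ℕ ℂ H) : H →L[ℂ] H :=
  (basisIsometry E (E.orthonormal.comp Nat.succ Nat.succ_injective)).toContinuousLinearMap

/-- The Toeplitz algebra `𝒯 = C*(U)`: the norm-closed `*`-subalgebra of `B(H)` generated by `U`. -/
abbrev toeplitzAlgebra (E : HilbertBasis ℕ ℂ H) : StarSubalgebra ℂ (H →L[ℂ] H) :=
  StarAlgebra.elemental ℂ (shift E)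

/-- The shift as an element of the Toeplitz algebra. -/
def shiftT (E : HilbertBasis ℕ ℂ H) : toeplitzAlgebra E :=
  ⟨shift E, StarAlgebra.elemental.self_mem ℂ (shift E)⟩

/-! ### Toeplitz operators -/

/-- The Hilbert space `L²(ℝ/ℤ)`, with respect to the normalized Haar measure. -/
abbrev L2Circle : Type := Lp ℂ 2 (AddCircle.haarAddCircle (T := (1 : ℝ)))

/-- Multiplication by a continuous function `f` on `L²(ℝ/ℤ)`. -/
def mulOp (f : C(AddCircle (1 : ℝ), ℂ)) : L2Circle →L[ℂ] L2Circle :=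
  (ContinuousLinearMap.mul ℂ ℂ).holderL AddCircle.haarAddCircle ⊤ 2 2
    (ContinuousMap.toLp ⊤ AddCircle.haarAddCircle ℂ f)

theorem orthonormal_fourier_nat :
    Orthonormal ℂ (fun k : ℕ => (fourierLp 2 (k : ℤ) : L2Circle)) :=
  orthonormal_fourier.comp (fun k : ℕ => (k : ℤ)) Nat.cast_injective

/-- The identification of `H = ℓ²(ℤ_{≥0})` with the closed subspace of `L²(ℝ/ℤ) = ℓ²(ℤ)` spanned
by the nonnegative frequencies: `E k` is sent to `x ↦ exp (2 π i k x)`. -/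
def hardyEmbedding (E : HilbertBasis ℕ ℂ H) : H →L[ℂ] L2Circle :=
  (basisIsometry E orthonormal_fourier_nat).toContinuousLinearMap

/-- The Toeplitz operator `T(f) = P M_f`, compressed to `H`. The adjoint of the embedding of `H` is
the orthogonal projection `P` onto `H`. -/
def toeplitzOp (E : HilbertBasis ℕ ℂ H) (f : C(AddCircle (1 : ℝ), ℂ)) : H →L[ℂ] H :=
  ContinuousLinearMap.adjoint (hardyEmbedding E) ∘L mulOp f ∘L hardyEmbedding E

/-- Smoothness of a function on `ℝ/ℤ`: its periodic lift to `ℝ` is `C^∞`. -/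
def IsSmoothOnCircle (f : C(AddCircle (1 : ℝ), ℂ)) : Prop :=
  ContDiff ℝ ((⊤ : ℕ∞) : WithTop ℕ∞) (fun x : ℝ => f (x : AddCircle (1 : ℝ)))

/-! ### Smooth compact operators and the smooth Toeplitz algebra -/

/-- Rapid decay of a double sequence. -/
def IsRD₂ (c : ℕ → ℕ → ℂ) : Prop :=
  ∀ N : ℕ, ∃ C : ℝ, ∀ k l : ℕ, (1 + (k : ℝ) + (l : ℝ)) ^ N * ‖c k l‖ ≤ C

/-- The matrix units `P k l`, with `P k l (E l) = E k`. -/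
def matrixUnit (E : HilbertBasis ℕ ℂ H) (k l : ℕ) : H →L[ℂ] H :=
  InnerProductSpace.rankOne ℂ (E k) (E l)

/-- The smooth compact operators `𝒦^∞`: operators `∑ c k l P k l` with rapidly decaying
coefficients. -/
def smoothCompact (E : HilbertBasis ℕ ℂ H) : Set (H →L[ℂ] H) :=
  {a | ∃ c : ℕ → ℕ → ℂ, IsRD₂ c ∧
    HasSum (fun p : ℕ × ℕ => c p.1 p.2 • matrixUnit E p.1 p.2) a}

/-- The smooth Toeplitz algebra `𝒯^∞ ⊆ 𝒯`: the elements `T(f) + c` with `f` smooth and `c` a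
smooth compact operator. -/
def smoothToeplitz (E : HilbertBasis ℕ ℂ H) : Set (toeplitzAlgebra E) :=
  {a | ∃ f : C(AddCircle (1 : ℝ), ℂ), IsSmoothOnCircle f ∧ ∃ c ∈ smoothCompact E,
    (a : H →L[ℂ] H) = toeplitzOp E f + c}

/-! ### The Fréchet space of rapidly decaying vectors -/

/-- Rapid decay of a sequence. -/
def IsRD (x : ℕ → ℂ) : Prop :=
  ∀ N : ℕ, ∃ C : ℝ, ∀ k : ℕ, (1 + (k : ℝ)) ^ N * ‖x k‖ ≤ C

/-- The space `S_ℰ` of vectors whose coefficients in the basis are rapidly decaying. -/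
def rapidDecay (E : HilbertBasis ℕ ℂ H) : Submodule ℂ H where
  carrier := {x | IsRD (fun k => E.repr x k)}
  zero_mem' := fun N => ⟨0, fun k => by simp⟩
  add_mem' := by
    intro x y hx hy N
    obtain ⟨C, hC⟩ := hx N
    obtain ⟨D, hD⟩ := hy N
    refine ⟨C + D, fun k => ?_⟩
    have h : ‖E.repr (x + y) k‖ ≤ ‖E.repr x k‖ + ‖E.repr y k‖ := by
      rw [map_add]
      exact norm_add_le _ _
    calc (1 + (k : ℝ)) ^ N * ‖E.repr (x + y) k‖
        ≤ (1 + (k : ℝ)) ^ N * (‖E.repr x k‖ + ‖E.repr y k‖) := by gcongr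
      _ ≤ C + D := by rw [mul_add]; exact add_le_add (hC k) (hD k)
  smul_mem' := by
    intro a x hx N
    obtain ⟨C, hC⟩ := hx N
    refine ⟨‖a‖ * C, fun k => ?_⟩
    have h : ‖E.repr (a • x) k‖ = ‖a‖ * ‖E.repr x k‖ := by
      rw [map_smul, lp.coeFn_smul, Pi.smul_apply, norm_smul]
    rw [h, mul_left_comm]
    exact mul_le_mul_of_nonneg_left (hC k) (norm_nonneg a)

theorem memℓp_weight {x : ℕ → ℂ} (hx : IsRD x) (N : ℕ) :
    Memℓp (fun k : ℕ => (1 + (k : ℂ)) ^ N * x k) 2 := by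
  obtain ⟨C, hC⟩ := hx (N + 1)
  refine memℓp_gen ?_
  have hs : Summable (fun k : ℕ => C ^ 2 * (1 / ((k + 1 : ℕ) : ℝ) ^ 2)) :=
    ((summable_nat_add_iff 1).2 (Real.summable_one_div_nat_pow.2 one_lt_two)).mul_left _
  refine Summable.of_nonneg_of_le (fun k => by positivity) (fun k => ?_) hs
  have hk : (0 : ℝ) < 1 + (k : ℝ) := by positivity
  have hn : ‖(1 + (k : ℂ))‖ = 1 + (k : ℝ) := by
    have : (1 + (k : ℂ)) = ((1 + (k : ℝ) : ℝ) : ℂ) := by push_cast; rfl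
    rw [this, Complex.norm_real, Real.norm_of_nonneg hk.le]
  have h1 := hC k
  have h2 : ‖(1 + (k : ℂ)) ^ N * x k‖ ≤ C / (1 + (k : ℝ)) := by
    rw [norm_mul, norm_pow, hn, le_div_iff₀ hk]
    calc (1 + (k : ℝ)) ^ N * ‖x k‖ * (1 + (k : ℝ))
        = (1 + (k : ℝ)) ^ (N + 1) * ‖x k‖ := by ring
      _ ≤ C := h1
  have h3 := pow_le_pow_left₀ (norm_nonneg _) h2 2
  have h4 : C ^ 2 * (1 / ((k + 1 : ℕ) : ℝ) ^ 2) = (C / (1 + (k : ℝ))) ^ 2 := by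
    push_cast
    rw [add_comm (k : ℝ) 1, div_pow]
    ring
  rw [h4]
  simpa using h3

/-- The operator `(I + 𝕂)^N` on rapidly decaying vectors, where `𝕂 (E k) = k E k`. -/
def weightOp (E : HilbertBasis ℕ ℂ H) (N : ℕ) : rapidDecay E →ₗ[ℂ] H where
  toFun x := E.repr.symm ⟨fun k : ℕ => (1 + (k : ℂ)) ^ N * E.repr (x : H) k, memℓp_weight x.2 N⟩
  map_add' x y := by
    rw [← map_add]
    congr 1
    ext k
    exact (congrArg (fun z => (1 + (k : ℂ)) ^ N * z)
      (congrArg (fun w : lp (fun _ : ℕ => ℂ) 2 => w k) (map_add E.repr (x : H) y))).trans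
      (mul_add _ _ _)
  map_smul' a x := by
    rw [RingHom.id_apply, ← map_smul]
    congr 1
    ext k
    simp [mul_left_comm]

/-- The norms `‖x‖_N = ‖(I + 𝕂)^N x‖` on `S_ℰ`. -/
def rapidDecaySeminorms (E : HilbertBasis ℕ ℂ H) : SeminormFamily ℂ (rapidDecay E) ℕ :=
  fun N => (normSeminorm ℂ H).comp (weightOp E N)

/-- The Fréchet topology of `S_ℰ`, defined by the norms `‖·‖_N`. It is not an instance, because
`S_ℰ` also carries the subspace topology of `H`. -/
abbrev rapidDecayTopology (E : HilbertBasis ℕ ℂ H) : TopologicalSpace (rapidDecay E) :=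
  (rapidDecaySeminorms E).moduleFilterBasis.topology

/-! ### Möbius transformations of the shift -/

/-- The denominator `conj β U + conj α` in the Toeplitz algebra, where `α = g 0 0` and
`β = g 0 1`. -/
def mobiusDenom (E : HilbertBasis ℕ ℂ H) (g : Matrix (Fin 2) (Fin 2) ℂ) : toeplitzAlgebra E :=
  star (g 0 1) • shiftT E + star (g 0 0) • 1

/-- `W_g = (α U + β) (conj β U + conj α)⁻¹`, where `α = g 0 0` and `β = g 0 1`. -/
def mobiusShift (E : HilbertBasis ℕ ℂ H) (g : Matrix (Fin 2) (Fin 2) ℂ) : toeplitzAlgebra E :=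
  (g 0 0 • shiftT E + g 0 1 • 1) * Ring.inverse (mobiusDenom E g)

end SmoothToeplitz

end

noncomputable section

namespace SmoothToeplitz

open MeasureTheory

variable {H : Type*} [NormedAddCommGroup H] [InnerProductSpace ℂ H] [CompleteSpace H]

/-! ### The shift and its Möbius transforms -/

/-! Since `‖β‖ < ‖α‖` and `U` is a contraction, a Neumann series inverts D = conj β U + conj α. From
U*U = 1 and |α|² - |β|² = 1 it follows that W is again an isometry (`star_moeb_mul_moeb`), and F₀ =
D⁻¹E₀ is a unit vector orthogonal to its range. Hence the vectors Wᵏ F₀ are orthonormal and E_k ↦ Wᵏ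
F₀ defines an isometry V with VU = WV. Its surjectivity comes from the group structure: the isometry
built from g⁻¹ is a right inverse (`moebIsometry_inv_right`). Conjugation by V therefore preserves
the Toeplitz algebra and gives ρ.

On Toeplitz operators the conjugation is exact, with no compact error: V T(f) V⁻¹ = T(f ∘ Φ), where
Φ is the Möbius map on the circle (`conj_toeplitzOp`). As Φ is smooth, smooth symbols stay smooth.

For smooth compact operators and for `rapidDecay` the matrix of V must be controlled. Weights rᵐ
with r > 1 slightly (analyticity of Wᵏ F₀ beyond the unit disc) show that column k of V is
exponentially small beyond row A k, for a fixed A; below that row unitarity bounds the entries by 1.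
So every polynomial row weight costs only a polynomial in k (`exists_coeff_moebIsometry_le`), which
rapid decay absorbs. -/

theorem shift_apply_basis (E : HilbertBasis ℕ ℂ H) (k : ℕ) : shift E (E k) = E (k + 1) :=
  basisIsometry_apply E (E.orthonormal.comp Nat.succ Nat.succ_injective) k

theorem norm_shift_apply (E : HilbertBasis ℕ ℂ H) (x : H) : ‖shift E x‖ = ‖x‖ :=
  LinearIsometry.norm_map _ x

theorem norm_shift_le (E : HilbertBasis ℕ ℂ H) : ‖shift E‖ ≤ 1 :=
  LinearIsometry.norm_toContinuousLinearMap_le _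

theorem star_shift_mul_shift (E : HilbertBasis ℕ ℂ H) : star (shift E) * shift E = 1 :=
  (ContinuousLinearMap.norm_map_iff_adjoint_comp_self _).1 (norm_shift_apply E)

theorem inner_shift_shift (E : HilbertBasis ℕ ℂ H) (x y : H) :
    inner ℂ (shift E x) (shift E y) = inner ℂ x y :=
  LinearIsometry.inner_map_map _ x y

/-- Bounded operators that agree on a Hilbert basis are equal. -/
theorem clm_ext_basis {F : Type*} [NormedAddCommGroup F] [NormedSpace ℂ F]
    (E : HilbertBasis ℕ ℂ H) {S T : H →L[ℂ] F} (h : ∀ k, S (E k) = T (E k)) : S = T := by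
  refine ContinuousLinearMap.ext_on
    (Submodule.dense_iff_topologicalClosure_eq_top.2 E.dense_span) ?_
  rintro _ ⟨k, rfl⟩
  exact h k

theorem ext_inner_basis (E : HilbertBasis ℕ ℂ H) {x y : H}
    (h : ∀ k, inner ℂ (E k) x = inner ℂ (E k) y) : x = y := by
  apply E.repr.injective
  ext k
  simpa only [HilbertBasis.repr_apply_apply] using h k

theorem adjoint_shift_basis_zero (E : HilbertBasis ℕ ℂ H) : star (shift E) (E 0) = 0 := by
  refine ext_inner_basis E fun k => ?_
  rw [ContinuousLinearMap.star_eq_adjoint, ContinuousLinearMap.adjoint_inner_right,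
    shift_apply_basis, inner_zero_right]
  exact E.orthonormal.2 (Nat.succ_ne_zero k)

theorem inner_basis_zero_shift (E : HilbertBasis ℕ ℂ H) (x : H) :
    inner ℂ (E 0) (shift E x) = 0 := by
  rw [← ContinuousLinearMap.adjoint_inner_left, ← ContinuousLinearMap.star_eq_adjoint,
    adjoint_shift_basis_zero, inner_zero_left]

theorem inner_basis_succ_shift (E : HilbertBasis ℕ ℂ H) (k : ℕ) (x : H) :
    inner ℂ (E (k + 1)) (shift E x) = inner ℂ (E k) x := by
  rw [← shift_apply_basis, inner_shift_shift]

theorem star_shiftT_mul_shiftT (E : HilbertBasis ℕ ℂ H) : star (shiftT E) * shiftT E = 1 :=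
  Subtype.ext (star_shift_mul_shift E)

instance (E : HilbertBasis ℕ ℂ H) : Module ℂ (toeplitzAlgebra E) := Algebra.toModule

instance (E : HilbertBasis ℕ ℂ H) : DistribMulAction ℂ (toeplitzAlgebra E) :=
  Module.toDistribMulAction

/-- The element `conj β U + conj α` of the Toeplitz algebra. -/
def moebDen (E : HilbertBasis ℕ ℂ H) (α β : ℂ) : toeplitzAlgebra E :=
  star β • shiftT E + star α • 1

/-- The element `α U + β` of the Toeplitz algebra. -/
def moebNum (E : HilbertBasis ℕ ℂ H) (α β : ℂ) : toeplitzAlgebra E :=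
  α • shiftT E + β • 1

/-- The element `(α U + β) (conj β U + conj α)⁻¹` of the Toeplitz algebra. -/
def moeb (E : HilbertBasis ℕ ℂ H) (α β : ℂ) : toeplitzAlgebra E :=
  moebNum E α β * Ring.inverse (moebDen E α β)

/-! ### Algebraic identities between U, W and the denominator. -/

section Algebra

variable (E : HilbertBasis ℕ ℂ H) {α β : ℂ} (h : ‖α‖ ^ 2 - ‖β‖ ^ 2 = 1)
include h

theorem norm_lt_of_su : ‖β‖ < ‖α‖ :=
  lt_of_pow_lt_pow_left₀ 2 (norm_nonneg _) (by linarith)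

theorem ne_zero_of_su : α ≠ 0 :=
  norm_pos_iff.1 ((norm_nonneg β).trans_lt (norm_lt_of_su h))

theorem mul_star_sub_of_su : α * star α - β * star β = 1 := by
  have h1 : ((‖α‖ ^ 2 - ‖β‖ ^ 2 : ℝ) : ℂ) = 1 := by rw [h]; simp
  rw [← h1]
  push_cast
  rw [← Complex.mul_conj', ← Complex.mul_conj']
  rfl

/-- Neumann series: after factoring out conj α, the perturbation of 1 has norm at most |β|/|α| < 1.
-/
theorem isUnit_moebDen : IsUnit (moebDen E α β) := by
  have ha : star α ≠ 0 := star_ne_zero.2 (ne_zero_of_su h)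
  have hn : ‖(-(star β / star α)) • shiftT E‖ < 1 := by
    rw [norm_smul, norm_neg, norm_div, norm_star, norm_star]
    refine (mul_le_of_le_one_right (by positivity) (norm_shift_le E)).trans_lt ?_
    rw [div_lt_one (norm_pos_iff.2 (ne_zero_of_su h))]
    exact norm_lt_of_su h
  have hu := (isUnit_one_sub_of_norm_lt_one hn).smul (Units.mk0 _ ha)
  convert hu using 1
  rw [moebDen, Units.smul_mk0, smul_sub, smul_smul, mul_neg, mul_div_cancel₀ _ ha]
  module

theorem moeb_mul_den : moeb E α β * moebDen E α β = moebNum E α β := by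
  rw [moeb, mul_assoc, Ring.inverse_mul_cancel _ (isUnit_moebDen E h), mul_one]

/-- Multiplied out, the U terms cancel and the determinant |α|² - |β|² = 1 remains. Thus the inverse
of the denominator is affine in W; this is the lower row of g⁻¹ acting on W. -/
theorem moebDen_left_inv : (α • 1 - star β • moeb E α β) * moebDen E α β = 1 := by
  rw [sub_mul, smul_mul_assoc, smul_mul_assoc, moeb_mul_den E h, one_mul, moebDen, moebNum]
  have := mul_star_sub_of_su h
  calc _ = (α * star α - β * star β) • (1 : toeplitzAlgebra E) := by module
    _ = 1 := by rw [this, one_smul]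

theorem inverse_moebDen :
    Ring.inverse (moebDen E α β) = α • 1 - star β • moeb E α β := by
  have h1 := moebDen_left_inv E h
  calc _ = (α • 1 - star β • moeb E α β) * moebDen E α β * Ring.inverse (moebDen E α β) := by
        rw [h1, one_mul]
    _ = _ := by rw [mul_assoc, Ring.mul_inverse_cancel _ (isUnit_moebDen E h), mul_one]

theorem moebDen_right_inv : moebDen E α β * (α • 1 - star β • moeb E α β) = 1 := by
  rw [← inverse_moebDen E h, Ring.mul_inverse_cancel _ (isUnit_moebDen E h)]

/-- The upper row of g⁻¹ acting on W. Together with `inverse_moebDen` it recovers U from W by the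
inverse Möbius transformation. -/
theorem star_smul_moeb_sub :
    star α • moeb E α β - β • 1 = shiftT E * (α • 1 - star β • moeb E α β) := by
  have key : (star α • moeb E α β - β • 1) * moebDen E α β = shiftT E := by
    rw [sub_mul, smul_mul_assoc, smul_mul_assoc, moeb_mul_den E h, one_mul, moebDen, moebNum]
    have := mul_star_sub_of_su h
    calc _ = (α * star α - β * star β) • shiftT E := by module
      _ = _ := by rw [this, one_smul]
  conv_rhs => rw [← key]
  rw [mul_assoc, moebDen_right_inv E h, mul_one]

/-- Using only U*U = 1, the numerator and the denominator have the same absolute square; the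
invertible denominator is then cancelled on both sides. -/
theorem star_moeb_mul_moeb : star (moeb E α β) * moeb E α β = 1 := by
  have hu := isUnit_moebDen E h
  refine hu.mul_right_cancel (hu.star.mul_left_cancel ?_)
  have e : star (moebNum E α β) * moebNum E α β = star (moebDen E α β) * moebDen E α β := by
    simp only [moebNum, moebDen, star_add, star_smul, star_star, star_one, mul_add, add_mul,
      smul_mul_smul_comm, star_shiftT_mul_shiftT, mul_one, one_mul]
    module
  calc _ = star (moeb E α β * moebDen E α β) * (moeb E α β * moebDen E α β) := by
        rw [star_mul]; simp only [mul_assoc]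
    _ = _ := by rw [moeb_mul_den E h, e, one_mul]

theorem norm_moeb_apply (x : H) : ‖(moeb E α β : H →L[ℂ] H) x‖ = ‖x‖ :=
  (ContinuousLinearMap.norm_map_iff_adjoint_comp_self _).2
    (congrArg Subtype.val (star_moeb_mul_moeb E h)) x

theorem inner_moeb_moeb (x y : H) :
    inner ℂ ((moeb E α β : H →L[ℂ] H) x) ((moeb E α β : H →L[ℂ] H) y) = inner ℂ x y :=
  (LinearMap.norm_map_iff_inner_map_map (moeb E α β : H →L[ℂ] H)).1
    (norm_moeb_apply E h) x y

end Algebra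

/-! ### The unitary implementing a Möbius transformation -/

/-- The vector `(conj β U + conj α)⁻¹ E₀`. -/
def vacuum (E : HilbertBasis ℕ ℂ H) (α β : ℂ) : H :=
  ((Ring.inverse (moebDen E α β) : toeplitzAlgebra E) : H →L[ℂ] H) (E 0)

theorem moebDen_apply (E : HilbertBasis ℕ ℂ H) (α β : ℂ) (x : H) :
    (moebDen E α β : H →L[ℂ] H) x = star β • shift E x + star α • x := rfl

section Unitary

variable (E : HilbertBasis ℕ ℂ H) {α β : ℂ} (h : ‖α‖ ^ 2 - ‖β‖ ^ 2 = 1)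
include h

theorem moebDen_inverse_apply (x : H) : (moebDen E α β : H →L[ℂ] H)
    (((Ring.inverse (moebDen E α β) : toeplitzAlgebra E) : H →L[ℂ] H) x) = x :=
  congrArg (fun a : toeplitzAlgebra E => (a : H →L[ℂ] H) x)
    (Ring.mul_inverse_cancel _ (isUnit_moebDen E h))

theorem inverse_moebDen_apply (x : H) :
    ((Ring.inverse (moebDen E α β) : toeplitzAlgebra E) : H →L[ℂ] H) x =
      α • x - star β • (moeb E α β : H →L[ℂ] H) x :=
  congrArg (fun a : toeplitzAlgebra E => (a : H →L[ℂ] H) x) (inverse_moebDen E h)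

theorem moeb_apply_moebDen (x : H) : (moeb E α β : H →L[ℂ] H) ((moebDen E α β : H →L[ℂ] H) x) =
    α • shift E x + β • x :=
  congrArg (fun a : toeplitzAlgebra E => (a : H →L[ℂ] H) x) (moeb_mul_den E h)

theorem moebDen_vacuum : star β • shift E (vacuum E α β) + star α • vacuum E α β = E 0 :=
  moebDen_inverse_apply E h (E 0)

/-- Applying U* to D F₀ = E₀ kills the right side, so F₀ is an eigenvector of U* with eigenvalue
-conj β / conj α. -/
theorem adjoint_shift_vacuum :
    star α • star (shift E) (vacuum E α β) = -(star β • vacuum E α β) := by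
  have h1 := congrArg (⇑(star (shift E))) (moebDen_vacuum E h)
  rw [adjoint_shift_basis_zero, map_add, map_smul, map_smul] at h1
  have h2 : star (shift E) (shift E (vacuum E α β)) = vacuum E α β :=
    congrArg (fun a : H →L[ℂ] H => a (vacuum E α β)) (star_shift_mul_shift E)
  rw [h2] at h1
  exact eq_neg_of_add_eq_zero_right h1

theorem inner_shift_vacuum (x : H) :
    α * inner ℂ (vacuum E α β) (shift E x) = -(β * inner ℂ (vacuum E α β) x) := by
  have h1 := congrArg (fun y => inner ℂ y x) (adjoint_shift_vacuum E h)
  simp only [inner_smul_left, inner_neg_left, ContinuousLinearMap.star_eq_adjoint,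
    ContinuousLinearMap.adjoint_inner_left] at h1
  simpa using h1

/-- Each x has the form D y, so W x = (α U + β) y, and the adjoint of α U + β annihilates F₀ by the
eigenvector equation. -/
theorem inner_vacuum_moeb (x : H) :
    inner ℂ (vacuum E α β) ((moeb E α β : H →L[ℂ] H) x) = 0 := by
  rw [← moebDen_inverse_apply E h x, moeb_apply_moebDen E h, inner_add_right, inner_smul_right,
    inner_smul_right, inner_shift_vacuum E h]
  ring

theorem inner_vacuum_vacuum : inner ℂ (vacuum E α β) (vacuum E α β) = 1 := by
  have ha := ne_zero_of_su h
  set F := vacuum E α β with hF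
  -- Expanding ⟨E₀, E₀⟩ = 1 with E₀ = D F in both slots, and eliminating ⟨U F, F⟩ by the eigenvector
  -- equation, leaves (|α|² - |β|²) ⟨F, F⟩ = 1.
  have h1 : inner ℂ (E 0) (star β • shift E F + star α • F) = 1 := by
    rw [moebDen_vacuum E h, inner_self_eq_norm_sq_to_K, E.orthonormal.1 0]
    simp
  rw [inner_add_right, inner_smul_right, inner_basis_zero_shift, mul_zero, zero_add,
    inner_smul_right, ← moebDen_vacuum E h, ← hF, inner_add_left, inner_smul_left, inner_smul_left,
    ← inner_conj_symm (shift E F) F] at h1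
  have h2 := congrArg (starRingEnd ℂ) (inner_shift_vacuum E h F)
  have h3 := mul_star_sub_of_su h
  simp only [map_mul, map_neg, starRingEnd_apply, star_star] at h1 h2 ⊢
  rw [← hF] at h2
  have h4 : star (inner ℂ F F) = inner ℂ F F := inner_conj_symm F F
  rw [h4] at h2
  linear_combination h1 - h3 * inner ℂ F F - β * h2

/-- F₀ is a wandering unit vector for W: common powers of the isometry W cancel, and F₀ is
orthogonal to its range. -/
theorem orthonormal_moeb_pow_vacuum : Orthonormal ℂ
    (fun k : ℕ => ((moeb E α β ^ k : toeplitzAlgebra E) : H →L[ℂ] H) (vacuum E α β)) := by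
  have hs : ∀ k : ℕ, ∀ x : H, ((moeb E α β ^ (k + 1) : toeplitzAlgebra E) : H →L[ℂ] H) x =
      (moeb E α β : H →L[ℂ] H) (((moeb E α β ^ k : toeplitzAlgebra E) : H →L[ℂ] H) x) :=
    fun k x => congrArg (fun a : toeplitzAlgebra E => (a : H →L[ℂ] H) x) (pow_succ' _ k)
  have h0 : ((moeb E α β ^ 0 : toeplitzAlgebra E) : H →L[ℂ] H) (vacuum E α β) = vacuum E α β :=
    congrArg (fun a : toeplitzAlgebra E => (a : H →L[ℂ] H) (vacuum E α β)) (pow_zero _)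
  rw [orthonormal_iff_ite]
  intro i
  induction i with
  | zero =>
    rintro (_ | j)
    · rw [h0, inner_vacuum_vacuum E h, if_pos rfl]
    · rw [h0, hs, inner_vacuum_moeb E h, if_neg (Nat.succ_ne_zero j).symm]
  | succ i ih =>
    rintro (_ | j)
    · rw [h0, hs, ← inner_conj_symm, inner_vacuum_moeb E h, map_zero,
        if_neg (Nat.succ_ne_zero i)]
    · rw [hs, hs, inner_moeb_moeb E h, ih]
      simp

/-- The isometry `E k ↦ W ^ k F₀`. -/
def moebIsometry : H →ₗᵢ[ℂ] H := basisIsometry E (orthonormal_moeb_pow_vacuum E h)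

theorem moebIsometry_basis (k : ℕ) : moebIsometry E h (E k) =
    ((moeb E α β ^ k : toeplitzAlgebra E) : H →L[ℂ] H) (vacuum E α β) :=
  basisIsometry_apply E _ k

theorem moebIsometry_shift (x : H) :
    moebIsometry E h (shift E x) = (moeb E α β : H →L[ℂ] H) (moebIsometry E h x) := by
  refine DFunLike.congr_fun (clm_ext_basis E
    (S := (moebIsometry E h).toContinuousLinearMap ∘L shift E)
    (T := (moeb E α β : H →L[ℂ] H) ∘L (moebIsometry E h).toContinuousLinearMap) fun k => ?_) x
  change moebIsometry E h (shift E (E k)) = (moeb E α β : H →L[ℂ] H) (moebIsometry E h (E k))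
  rw [shift_apply_basis, moebIsometry_basis, moebIsometry_basis]
  exact congrArg (fun a : toeplitzAlgebra E => (a : H →L[ℂ] H) (vacuum E α β)) (pow_succ' _ k)

theorem moebIsometry_basis_zero : moebIsometry E h (E 0) = vacuum E α β :=
  (moebIsometry_basis E h 0).trans
    (congrArg (fun a : toeplitzAlgebra E => (a : H →L[ℂ] H) (vacuum E α β)) (pow_zero _))

/-- The pair (conj α, -β) is the first row of g⁻¹. -/
theorem su_inv : ‖star α‖ ^ 2 - ‖-β‖ ^ 2 = 1 := by rwa [norm_star, norm_neg]

theorem moebIsometry_moebDen_inv (x : H) :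
    moebIsometry E h ((moebDen E (star α) (-β) : H →L[ℂ] H) x) =
      ((Ring.inverse (moebDen E α β) : toeplitzAlgebra E) : H →L[ℂ] H) (moebIsometry E h x) := by
  rw [moebDen_apply, map_add, map_smul, map_smul, moebIsometry_shift, inverse_moebDen_apply E h,
    star_star, star_neg, neg_smul, neg_add_eq_sub]

/-- V intertwines U with W, hence the Möbius transform of U under g⁻¹ with that of W, which is U. -/
theorem moebIsometry_moeb_inv (x : H) :
    moebIsometry E h ((moeb E (star α) (-β) : H →L[ℂ] H) x) =
      shift E (moebIsometry E h x) := by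
  obtain ⟨y, rfl⟩ : ∃ y, (moebDen E (star α) (-β) : H →L[ℂ] H) y = x :=
    ⟨_, moebDen_inverse_apply E (su_inv h) x⟩
  rw [moeb_apply_moebDen E (su_inv h), map_add, map_smul, map_smul, moebIsometry_shift,
    moebIsometry_moebDen_inv E h, inverse_moebDen E h, neg_smul, ← sub_eq_add_neg]
  exact congrArg (fun a : toeplitzAlgebra E => (a : H →L[ℂ] H) (moebIsometry E h y))
    (star_smul_moeb_sub E h)

theorem moebIsometry_vacuum_inv : moebIsometry E h (vacuum E (star α) (-β)) = E 0 := by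
  have h1 := moebIsometry_moebDen_inv E h (vacuum E (star α) (-β))
  have h2 : (moebDen E (star α) (-β) : H →L[ℂ] H) (vacuum E (star α) (-β)) = E 0 :=
    moebDen_vacuum E (su_inv h)
  rw [h2, moebIsometry_basis_zero] at h1
  have h3 := congrArg (moebDen E α β : H →L[ℂ] H) h1
  rw [moebDen_inverse_apply E h, vacuum, moebDen_inverse_apply E h] at h3
  exact h3.symm

/-- The composite commutes with U and fixes E₀, hence fixes every basis vector. This is what makes V
surjective. -/
theorem moebIsometry_inv_right (x : H) :
    moebIsometry E h (moebIsometry E (su_inv h) x) = x := by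
  refine DFunLike.congr_fun (clm_ext_basis E (S := (moebIsometry E h).toContinuousLinearMap ∘L
    (moebIsometry E (su_inv h)).toContinuousLinearMap)
    (T := ContinuousLinearMap.id ℂ H) fun k => ?_) x
  change moebIsometry E h (moebIsometry E (su_inv h) (E k)) = E k
  induction k with
  | zero => rw [moebIsometry_basis_zero, moebIsometry_vacuum_inv]
  | succ k ih =>
    rw [← shift_apply_basis, moebIsometry_shift, moebIsometry_moeb_inv, ih]

/-- The unitary `E k ↦ W ^ k F₀`. -/
def moebUnitary : H ≃ₗᵢ[ℂ] H :=
  LinearIsometryEquiv.ofSurjective (moebIsometry E h)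
    fun x => ⟨_, moebIsometry_inv_right E h x⟩

theorem moebUnitary_apply (x : H) : moebUnitary E h x = moebIsometry E h x := rfl

/-! ### The automorphism of the Toeplitz algebra -/

theorem conj_moebUnitary_shift :
    (moebUnitary E h).conjStarAlgEquiv (shift E) = (moeb E α β : H →L[ℂ] H) := by
  ext x
  rw [LinearIsometryEquiv.conjStarAlgEquiv_apply_apply, moebUnitary_apply, moebIsometry_shift,
    ← moebUnitary_apply, LinearIsometryEquiv.apply_symm_apply]

theorem conj_symm_moebUnitary_shift :
    (moebUnitary E h).symm.conjStarAlgEquiv (shift E) =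
      (moeb E (star α) (-β) : H →L[ℂ] H) := by
  ext x
  rw [LinearIsometryEquiv.conjStarAlgEquiv_apply_apply, LinearIsometryEquiv.symm_symm,
    LinearIsometryEquiv.symm_apply_eq, moebUnitary_apply, moebUnitary_apply,
    moebIsometry_moeb_inv]

omit h in
theorem continuous_conjStarAlgEquiv (V : H ≃ₗᵢ[ℂ] H) :
    Continuous fun a : H →L[ℂ] H => V.conjStarAlgEquiv a := by
  simp only [LinearIsometryEquiv.conjStarAlgEquiv_apply]
  fun_prop

omit h in
-- The preimage of the Toeplitz algebra under conjugation is a closed *-subalgebra, so it suffices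
-- that it contains U.
theorem conj_mem_toeplitzAlgebra (V : H ≃ₗᵢ[ℂ] H)
    (hV : V.conjStarAlgEquiv (shift E) ∈ toeplitzAlgebra E) {a : H →L[ℂ] H}
    (ha : a ∈ toeplitzAlgebra E) : V.conjStarAlgEquiv a ∈ toeplitzAlgebra E := by
  have hle : toeplitzAlgebra E ≤ (toeplitzAlgebra E).comap
      (StarAlgHomClass.toStarAlgHom V.conjStarAlgEquiv) :=
    StarAlgebra.elemental.le_of_mem
      ((StarAlgebra.elemental.isClosed (R := ℂ) (shift E)).preimage (continuous_conjStarAlgEquiv V)) hV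
  exact hle ha

/-- The automorphism of the Toeplitz algebra implemented by `moebUnitary`. -/
def moebAut : toeplitzAlgebra E ≃⋆ₐ[ℂ] toeplitzAlgebra E where
  toFun a := ⟨(moebUnitary E h).conjStarAlgEquiv a, conj_mem_toeplitzAlgebra E _
    (conj_moebUnitary_shift E h ▸ (moeb E α β).2) a.2⟩
  invFun a := ⟨(moebUnitary E h).symm.conjStarAlgEquiv a, conj_mem_toeplitzAlgebra E _
    (conj_symm_moebUnitary_shift E h ▸ (moeb E (star α) (-β)).2) a.2⟩
  left_inv a := by
    ext x
    simp
  right_inv a := by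
    ext x
    simp
  map_mul' a b := Subtype.ext (map_mul _ (a : H →L[ℂ] H) b)
  map_add' a b := Subtype.ext (map_add _ (a : H →L[ℂ] H) b)
  map_star' a := Subtype.ext (map_star _ (a : H →L[ℂ] H))
  map_smul' c a := Subtype.ext (map_smul _ c (a : H →L[ℂ] H))

theorem moebAut_apply (a : toeplitzAlgebra E) (x : H) : (moebAut E h a : H →L[ℂ] H) x =
    moebUnitary E h ((a : H →L[ℂ] H) ((moebUnitary E h).symm x)) := rfl

theorem moebAut_shiftT : moebAut E h (shiftT E) = moeb E α β :=
  Subtype.ext (conj_moebUnitary_shift E h)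

omit h in
theorem starAlgEquiv_ext_shiftT {ρ σ : toeplitzAlgebra E ≃⋆ₐ[ℂ] toeplitzAlgebra E}
    (hρ : ρ (shiftT E) = σ (shiftT E)) : ρ = σ := by
  have hc : ∀ τ : toeplitzAlgebra E ≃⋆ₐ[ℂ] toeplitzAlgebra E, Continuous τ := fun τ =>
    (StarAlgEquiv.isometry τ).continuous
  ext1 a
  exact DFunLike.congr_fun (StarAlgebra.elemental.starAlgHomClass_ext ℂ (a := shift E)
    (φ := ρ)
    (ψ := σ) (hc ρ) (hc σ) hρ) a

end Unitary

/-- Comparing coefficients in D F₀ = E₀ gives a two-term recursion, solved by the geometric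
sequence. -/
theorem inner_basis_vacuum (E : HilbertBasis ℕ ℂ H) {α β : ℂ} (h : ‖α‖ ^ 2 - ‖β‖ ^ 2 = 1)
    (k : ℕ) : inner ℂ (E k) (vacuum E α β) = (-star β) ^ k / star α ^ (k + 1) := by
  have ha : star α ≠ 0 := star_ne_zero.2 (ne_zero_of_su h)
  have h1 : ∀ k, star β * inner ℂ (E k) (shift E (vacuum E α β)) +
      star α * inner ℂ (E k) (vacuum E α β) = inner ℂ (E k) (E 0) := fun k => by
    rw [← moebDen_vacuum E h, inner_add_right, inner_smul_right, inner_smul_right]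
  induction k with
  | zero =>
    have h2 := h1 0
    rw [inner_basis_zero_shift, inner_self_eq_norm_sq_to_K, E.orthonormal.1 0] at h2
    field_simp
    simpa [mul_comm] using h2
  | succ k ih =>
    have h2 := h1 (k + 1)
    rw [inner_basis_succ_shift, E.orthonormal.2 (Nat.succ_ne_zero k), ih] at h2
    field_simp at h2 ⊢
    linear_combination h2

theorem hasSum_vacuum (E : HilbertBasis ℕ ℂ H) {α β : ℂ} (h : ‖α‖ ^ 2 - ‖β‖ ^ 2 = 1) :
    HasSum (fun k : ℕ => ((-star β) ^ k / star α ^ (k + 1)) • E k) (vacuum E α β) := by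
  have h1 := E.hasSum_repr (vacuum E α β)
  simpa only [HilbertBasis.repr_apply_apply, inner_basis_vacuum E h] using h1

/-! ### Toeplitz operators -/

theorem coeFn_mulOp (f : C(AddCircle (1 : ℝ), ℂ)) (x : L2Circle) :
    mulOp f x =ᵐ[AddCircle.haarAddCircle] fun t => f t * x t := by
  have h1 := (ContinuousLinearMap.mul ℂ ℂ).coeFn_holder (r := 2)
    (ContinuousMap.toLp ⊤ AddCircle.haarAddCircle ℂ f) x
  have h2 := ContinuousMap.coeFn_toLp (p := ⊤) (𝕜 := ℂ) (AddCircle.haarAddCircle (T := 1)) f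
  filter_upwards [h1, h2] with t h1 h2
  rw [← h2]
  exact h1

theorem mulOp_mul (f g : C(AddCircle (1 : ℝ), ℂ)) (x : L2Circle) :
    mulOp (f * g) x = mulOp f (mulOp g x) := by
  refine Lp.ext ?_
  filter_upwards [coeFn_mulOp (f * g) x, coeFn_mulOp f (mulOp g x), coeFn_mulOp g x]
    with t h1 h2 h3
  rw [h1, h2, h3, ContinuousMap.mul_apply, mul_assoc]

theorem mulOp_one (x : L2Circle) : mulOp 1 x = x := by
  refine Lp.ext ?_
  filter_upwards [coeFn_mulOp 1 x] with t h1
  rw [h1, ContinuousMap.one_apply, one_mul]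

theorem mulOp_fourier (m n : ℤ) :
    mulOp (fourier m) (fourierLp 2 n : L2Circle) = fourierLp 2 (m + n) := by
  refine Lp.ext ?_
  filter_upwards [coeFn_mulOp (fourier m) (fourierLp 2 n : L2Circle), coeFn_fourierLp 2 n,
    coeFn_fourierLp 2 (m + n)] with t h1 h2 h3
  rw [h1, h2, h3, fourier_add]

theorem inner_mulOp_star (f : C(AddCircle (1 : ℝ), ℂ)) (x y : L2Circle) :
    inner ℂ x (mulOp (star f) y) = inner ℂ (mulOp f x) y := by
  rw [L2.inner_def, L2.inner_def]
  refine integral_congr_ae ?_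
  filter_upwards [coeFn_mulOp f x, coeFn_mulOp (star f) y] with t h1 h2
  rw [h1, h2]
  simp
  ring

theorem hardyEmbedding_basis (E : HilbertBasis ℕ ℂ H) (k : ℕ) :
    hardyEmbedding E (E k) = (fourierLp 2 (k : ℤ) : L2Circle) :=
  basisIsometry_apply E orthonormal_fourier_nat k

theorem adjoint_hardyEmbedding_comp (E : HilbertBasis ℕ ℂ H) (x : H) :
    ContinuousLinearMap.adjoint (hardyEmbedding E) (hardyEmbedding E x) = x :=
  DFunLike.congr_fun ((ContinuousLinearMap.norm_map_iff_adjoint_comp_self (hardyEmbedding E)).1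
    fun x => LinearIsometry.norm_map _ x) x

theorem hardyEmbedding_shift (E : HilbertBasis ℕ ℂ H) (x : H) :
    hardyEmbedding E (shift E x) = mulOp (fourier 1) (hardyEmbedding E x) := by
  refine DFunLike.congr_fun (clm_ext_basis E (S := hardyEmbedding E ∘L shift E)
    (T := mulOp (fourier 1) ∘L hardyEmbedding E) fun k => ?_) x
  change hardyEmbedding E (shift E (E k)) = mulOp (fourier 1) (hardyEmbedding E (E k))
  rw [shift_apply_basis, hardyEmbedding_basis, hardyEmbedding_basis, mulOp_fourier]
  push_cast
  rw [add_comm]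

/-- The symbol map `f ↦ T(f)` as a continuous linear map. -/
def toeplitzCLM (E : HilbertBasis ℕ ℂ H) : C(AddCircle (1 : ℝ), ℂ) →L[ℂ] (H →L[ℂ] H) :=
  (ContinuousLinearMap.precomp H (hardyEmbedding E)) ∘L
  (ContinuousLinearMap.postcomp L2Circle (ContinuousLinearMap.adjoint (hardyEmbedding E))) ∘L
  ((ContinuousLinearMap.mul ℂ ℂ).holderL AddCircle.haarAddCircle ⊤ 2 2) ∘L
  (ContinuousMap.toLp ⊤ AddCircle.haarAddCircle ℂ)

theorem toeplitzCLM_apply (E : HilbertBasis ℕ ℂ H) (f : C(AddCircle (1 : ℝ), ℂ)) :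
    toeplitzCLM E f = toeplitzOp E f := rfl

/-- An analytic factor placed on the right maps the Hardy space into itself, so no projection
intervenes and multiplicativity is exact. -/
theorem toeplitzOp_mul_fourier_one (E : HilbertBasis ℕ ℂ H) (f : C(AddCircle (1 : ℝ), ℂ)) :
    toeplitzOp E (f * fourier 1) = toeplitzOp E f * shift E := by
  ext x
  change ContinuousLinearMap.adjoint (hardyEmbedding E) (mulOp (f * fourier 1)
    (hardyEmbedding E x)) = ContinuousLinearMap.adjoint (hardyEmbedding E) (mulOp f
    (hardyEmbedding E (shift E x)))
  rw [mulOp_mul, hardyEmbedding_shift]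

theorem toeplitzOp_one (E : HilbertBasis ℕ ℂ H) : toeplitzOp E 1 = 1 := by
  ext x
  change ContinuousLinearMap.adjoint (hardyEmbedding E) (mulOp 1 (hardyEmbedding E x)) = x
  rw [mulOp_one, adjoint_hardyEmbedding_comp]

theorem toeplitzOp_star (E : HilbertBasis ℕ ℂ H) (f : C(AddCircle (1 : ℝ), ℂ)) :
    toeplitzOp E (star f) = star (toeplitzOp E f) := by
  rw [ContinuousLinearMap.star_eq_adjoint, ContinuousLinearMap.eq_adjoint_iff]
  intro x y
  change inner ℂ (ContinuousLinearMap.adjoint (hardyEmbedding E) (mulOp (star f)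
    (hardyEmbedding E x))) y = inner ℂ x (ContinuousLinearMap.adjoint (hardyEmbedding E) (mulOp f
    (hardyEmbedding E y)))
  rw [ContinuousLinearMap.adjoint_inner_left, ContinuousLinearMap.adjoint_inner_right,
    ← inner_mulOp_star, star_star]

/-! ### The Möbius transformation on the circle -/

/-- The angle function `arg α + arg (1 + (β / α) z)`. -/
def moebAngle (α β z : ℂ) : ℝ := (Complex.arg α + Complex.arg (1 + β / α * z)) / Real.pi

theorem one_add_mem_slitPlane {α β : ℂ} (h : ‖β‖ < ‖α‖) {z : ℂ} (hz : ‖z‖ = 1) :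
    1 + β / α * z ∈ Complex.slitPlane := by
  have hpos : 0 < ‖α‖ := (norm_nonneg β).trans_lt h
  have h1 : ‖β / α * z‖ < 1 := by
    rw [norm_mul, norm_div, hz, mul_one, div_lt_one hpos]
    exact h
  exact Complex.mem_slitPlane_of_norm_lt_one h1

theorem norm_fourier_apply (n : ℤ) (t : AddCircle (1 : ℝ)) : ‖fourier n t‖ = 1 :=
  Circle.norm_coe _

theorem continuous_moebAngle_fourier {α β : ℂ} (h : ‖β‖ < ‖α‖) :
    Continuous fun t : AddCircle (1 : ℝ) => moebAngle α β (fourier (-1) t) := by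
  refine (continuous_const.add ?_).div_const _
  refine continuous_iff_continuousAt.2 fun t => ?_
  refine ContinuousAt.comp (g := Complex.arg)
    (Complex.continuousAt_arg (one_add_mem_slitPlane h (norm_fourier_apply (-1) t))) ?_
  fun_prop

/-- The Möbius transformation `z ↦ (α z + β) / (conj β z + conj α)` of the circle, in the
coordinate `z = exp (2 π i t)`. -/
def circleMoeb {α β : ℂ} (h : ‖β‖ < ‖α‖) : C(AddCircle (1 : ℝ), AddCircle (1 : ℝ)) where
  toFun t := t + ((moebAngle α β (fourier (-1) t) : ℝ) : AddCircle (1 : ℝ))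
  continuous_toFun := continuous_id.add
    ((AddCircle.continuous_mk' 1).comp (continuous_moebAngle_fourier h))

theorem exp_two_arg (w : ℂ) : Complex.exp (2 * (Complex.arg w : ℂ) * Complex.I) * star w = w := by
  have h1 := Complex.norm_mul_exp_arg_mul_I w
  have h2 : star w = ‖w‖ * Complex.exp (-(Complex.arg w * Complex.I)) := by
    change starRingEnd ℂ w = _
    conv_lhs => rw [← h1]
    rw [map_mul, Complex.conj_ofReal, ← Complex.exp_conj, map_mul, Complex.conj_I,
      Complex.conj_ofReal, mul_neg]
  conv_rhs => rw [← h1]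
  rw [h2, mul_left_comm, ← Complex.exp_add]
  ring_nf

/-- On |z| = 1 the Möbius map equals z · (α / conj α) · (w / conj w) with w = 1 + (β/α) conj z. Each
quotient of a number by its conjugate is exp(2i arg); dividing the arguments by π converts to the
coordinate t. -/
theorem fourier_one_circleMoeb {α β : ℂ} (h : ‖β‖ < ‖α‖) (t : AddCircle (1 : ℝ)) :
    fourier 1 (circleMoeb h t) * (star β * fourier 1 t + star α) = α * fourier 1 t + β := by
  have hα : α ≠ 0 := norm_pos_iff.1 ((norm_nonneg β).trans_lt h)
  have hπ : (Real.pi : ℂ) ≠ 0 := by exact_mod_cast Real.pi_ne_zero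
  set z : ℂ := fourier 1 t with hz
  have hz1 : (fourier (-1) t : ℂ) = star z := by rw [fourier_neg]; rfl
  have hzz : z * star z = 1 := by
    have := Complex.mul_conj' z
    rw [norm_fourier_apply] at this
    simpa using this
  have h1 : (fourier 1 (circleMoeb h t) : ℂ) = z *
      Complex.exp (2 * (Complex.arg α : ℂ) * Complex.I) *
      Complex.exp (2 * (Complex.arg (1 + β / α * star z) : ℂ) * Complex.I) := by
    change (fourier 1 (t + ((moebAngle α β (fourier (-1) t) : ℝ) : AddCircle (1 : ℝ))) : ℂ) = _
    rw [fourier_one, AddCircle.toCircle_add, Circle.coe_mul, ← fourier_one, ← hz,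
      ← fourier_one, fourier_coe_apply, hz1, mul_assoc z, ← Complex.exp_add, moebAngle]
    congr 2
    push_cast
    field_simp
  have h2 := exp_two_arg α
  have h3 := exp_two_arg (1 + β / α * star z)
  simp only [star_add, star_one, star_mul', star_div₀, star_star] at h3
  have hα' : star α ≠ 0 := star_ne_zero.2 hα
  rw [h1]
  calc _ = z * (Complex.exp (2 * (Complex.arg α : ℂ) * Complex.I) * star α) *
        (Complex.exp (2 * (Complex.arg (1 + β / α * star z) : ℂ) * Complex.I) *
        (1 + star β / star α * z)) := by
          field_simp
          ring
    _ = z * α * (1 + β / α * star z) := by rw [h2, h3]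
    _ = α * z + β * (z * star z) := by field_simp
    _ = _ := by rw [hzz, mul_one]

/-- The lift of the circle map is x plus an angle; its variable part is the imaginary part of the
logarithm of a point in the open unit disc about 1, where the principal branch is smooth. -/
theorem isSmoothOnCircle_comp_circleMoeb {α β : ℂ} (h : ‖β‖ < ‖α‖)
    {f : C(AddCircle (1 : ℝ), ℂ)} (hf : IsSmoothOnCircle f) :
    IsSmoothOnCircle (f.comp (circleMoeb h)) := by
  have h1 : ContDiff ℝ ((⊤ : ℕ∞) : WithTop ℕ∞)
      (fun x : ℝ => x + moebAngle α β (fourier (-1) (x : AddCircle (1 : ℝ)))) := by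
    refine contDiff_id.add ((contDiff_const.add ?_).div_const _)
    have harg : ∀ w : ℂ, Complex.arg w = Complex.imCLM (Complex.log w) :=
      fun w => (Complex.log_im w).symm
    simp only [harg]
    refine Complex.imCLM.contDiff.comp (contDiff_iff_contDiffAt.2 fun x => ?_)
    have hs := one_add_mem_slitPlane h (norm_fourier_apply (-1) (x : AddCircle (1 : ℝ)))
    refine ContDiffAt.comp (g := Complex.log)
      (f := fun x : ℝ => 1 + β / α * (fourier (-1) (x : AddCircle (1 : ℝ)) : ℂ)) x
      ((Complex.contDiffAt_log hs).restrict_scalars ℝ) ?_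
    refine (contDiff_const.add (contDiff_const.mul ?_)).contDiffAt
    simp only [fourier_coe_apply]
    have hx : ContDiff ℝ ((⊤ : ℕ∞) : WithTop ℕ∞) (fun x : ℝ => (x : ℂ)) :=
      Complex.ofRealCLM.contDiff
    fun_prop
  exact hf.comp h1

/-! ### Covariance of Toeplitz operators under the Möbius unitary. -/

section Covariance

variable (E : HilbertBasis ℕ ℂ H) {α β : ℂ} (h : ‖α‖ ^ 2 - ‖β‖ ^ 2 = 1)
include h

/-- If p is the boundary function of W, then p (conj β z + conj α) = α z + β. Multiplicativity for
right analytic factors gives T(f p) D = T(f) W D, and D cancels. -/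
theorem toeplitzOp_fourier_one_circleMoeb (f : C(AddCircle (1 : ℝ), ℂ)) :
    toeplitzOp E (f * (fourier 1 : C(AddCircle (1 : ℝ), ℂ)).comp (circleMoeb (norm_lt_of_su h))) =
      toeplitzOp E f * moeb E α β := by
  set p := (fourier 1 : C(AddCircle (1 : ℝ), ℂ)).comp (circleMoeb (norm_lt_of_su h)) with hp
  have hlin : ∀ (f : C(AddCircle (1 : ℝ), ℂ)) (a b : ℂ),
      toeplitzOp E (a • (f * fourier 1) + b • f) = toeplitzOp E f * (a • shift E + b • 1) := by
    intro f a b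
    rw [← toeplitzCLM_apply, map_add, map_smul, map_smul, toeplitzCLM_apply, toeplitzCLM_apply,
      toeplitzOp_mul_fourier_one, mul_add, mul_smul_comm, mul_smul_comm, mul_one]
  have h1 : star β • (f * p * fourier 1) + star α • (f * p) = α • (f * fourier 1) + β • f := by
    ext t
    have := fourier_one_circleMoeb (norm_lt_of_su h) t
    change star β * (f t * fourier 1 (circleMoeb (norm_lt_of_su h) t) * fourier 1 t) + star α *
      (f t * fourier 1 (circleMoeb (norm_lt_of_su h) t)) = α * (f t * fourier 1 t) + β * f t
    linear_combination f t * this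
  have h2 := congrArg (toeplitzOp E) h1
  rw [hlin, hlin] at h2
  have h3 : (moeb E α β : H →L[ℂ] H) * (moebDen E α β : H →L[ℂ] H) = moebNum E α β :=
    congrArg Subtype.val (moeb_mul_den E h)
  have hu : IsUnit (moebDen E α β : H →L[ℂ] H) :=
    (isUnit_moebDen E h).map (toeplitzAlgebra E).subtype
  refine hu.mul_right_cancel ?_
  rw [mul_assoc, h3]
  exact h2

theorem conj_toeplitzOp_fourier_nat (n : ℕ) :
    (moebUnitary E h).conjStarAlgEquiv (toeplitzOp E (fourier (n : ℤ))) =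
      toeplitzOp E ((fourier (n : ℤ)).comp (circleMoeb (norm_lt_of_su h))) := by
  induction n with
  | zero =>
    have h0 : (fourier ((0 : ℕ) : ℤ) : C(AddCircle (1 : ℝ), ℂ)) = 1 := by ext t; simp
    rw [h0, ContinuousMap.one_comp, toeplitzOp_one, map_one]
  | succ n ih =>
    have hs : (fourier ((n + 1 : ℕ) : ℤ) : C(AddCircle (1 : ℝ), ℂ)) = fourier n * fourier 1 := by
      ext t
      push_cast
      rw [fourier_add]
      rfl
    rw [hs, toeplitzOp_mul_fourier_one, map_mul, ih, conj_moebUnitary_shift,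
      ContinuousMap.mul_comp, toeplitzOp_fourier_one_circleMoeb E h]

/-- Both sides are continuous and linear in f and respect adjoints, so density of trigonometric
polynomials reduces the claim to nonnegative frequencies. -/
theorem conj_toeplitzOp (f : C(AddCircle (1 : ℝ), ℂ)) :
    (moebUnitary E h).conjStarAlgEquiv (toeplitzOp E f) =
      toeplitzOp E (f.comp (circleMoeb (norm_lt_of_su h))) := by
  set Φ := circleMoeb (norm_lt_of_su h)
  have hstar : ∀ f : C(AddCircle (1 : ℝ), ℂ),
      (moebUnitary E h).conjStarAlgEquiv (toeplitzOp E f) = toeplitzOp E (f.comp Φ) →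
      (moebUnitary E h).conjStarAlgEquiv (toeplitzOp E (star f)) =
        toeplitzOp E ((star f).comp Φ) := by
    intro f hf
    rw [toeplitzOp_star, map_star, hf, ← toeplitzOp_star]
    rfl
  have hc1 : Continuous fun f => (moebUnitary E h).conjStarAlgEquiv (toeplitzOp E f) :=
    (continuous_conjStarAlgEquiv (moebUnitary E h)).comp (toeplitzCLM E).continuous
  have hc2 : Continuous fun f : C(AddCircle (1 : ℝ), ℂ) => toeplitzOp E (f.comp Φ) := by
    simp only [← toeplitzCLM_apply]
    exact (toeplitzCLM E).continuous.comp (ContinuousMap.continuous_precomp Φ)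
  have hmem : f ∈ (Submodule.span ℂ
      (Set.range (fourier : ℤ → C(AddCircle (1 : ℝ), ℂ)))).topologicalClosure := by
    rw [span_fourier_closure_eq_top]
    trivial
  refine closure_minimal (s := (Submodule.span ℂ
    (Set.range (fourier : ℤ → C(AddCircle (1 : ℝ), ℂ))) : Set C(AddCircle (1 : ℝ), ℂ)))
    (fun f hf => ?_) (isClosed_eq hc1 hc2) hmem
  induction hf using Submodule.span_induction with
  | mem f hf =>
    obtain ⟨n, rfl⟩ := hf
    obtain ⟨n, rfl | rfl⟩ := n.eq_nat_or_neg
    · exact conj_toeplitzOp_fourier_nat E h n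
    · have hn : (fourier (-(n : ℤ)) : C(AddCircle (1 : ℝ), ℂ)) = star (fourier (n : ℤ)) := by
        ext t
        rw [fourier_neg]
        rfl
      rw [hn]
      exact hstar _ (conj_toeplitzOp_fourier_nat E h n)
  | zero =>
    simp only [Set.mem_ofPred_eq, ContinuousMap.zero_comp, ← toeplitzCLM_apply, map_zero]
  | add f g _ _ hf hg =>
    simp only [Set.mem_ofPred_eq, ContinuousMap.add_comp, ← toeplitzCLM_apply, map_add] at hf hg ⊢
    rw [hf, hg]
  | smul a f _ hf =>
    simp only [Set.mem_ofPred_eq, ContinuousMap.smul_comp, ← toeplitzCLM_apply, map_smul] at hf ⊢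
    rw [hf]

end Covariance

/-! ### Decay of the matrix coefficients -/

section Coefficients

variable (E : HilbertBasis ℕ ℂ H) {α β : ℂ} {r : ℝ}

/-- In the sup norm weighted by rᵐ the shift has norm at most r, so D is bounded below by |α| -
r|β|. The proof runs the recursion for the coefficients upwards in m. -/
theorem coeff_le_of_moebDen (hr : 0 ≤ r) (hd : 0 < ‖α‖ - r * ‖β‖) {C : ℝ} {y : H}
    (hy : ∀ m, ‖inner ℂ (E m) ((moebDen E α β : H →L[ℂ] H) y)‖ * r ^ m ≤ C) (m : ℕ) :
    ‖inner ℂ (E m) y‖ * r ^ m ≤ C / (‖α‖ - r * ‖β‖) := by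
  have hC : 0 ≤ C := le_trans (by positivity) (hy 0)
  have hα : 0 < ‖α‖ := lt_of_lt_of_le hd (sub_le_self _ (by positivity))
  simp only [moebDen_apply, inner_add_right, inner_smul_right] at hy
  induction m with
  | zero =>
    have h0 := hy 0
    rw [inner_basis_zero_shift, mul_zero, zero_add, norm_mul, norm_star, pow_zero, mul_one] at h0
    rw [pow_zero, mul_one, le_div_iff₀ hd]
    nlinarith [mul_nonneg (norm_nonneg (inner ℂ (E 0) y)) (mul_nonneg hr (norm_nonneg β))]
  | succ m ih =>
    have h1 := hy (m + 1)
    rw [inner_basis_succ_shift] at h1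
    have h2 : ‖α‖ * ‖inner ℂ (E (m + 1)) y‖ ≤
        ‖star β * inner ℂ (E m) y + star α * inner ℂ (E (m + 1)) y‖ +
          ‖β‖ * ‖inner ℂ (E m) y‖ := by
      have := norm_sub_le (star β * inner ℂ (E m) y + star α * inner ℂ (E (m + 1)) y)
        (star β * inner ℂ (E m) y)
      rwa [add_sub_cancel_left, norm_mul, norm_mul (star β), norm_star, norm_star] at this
    have h3 := mul_le_mul_of_nonneg_right h2 (pow_nonneg hr (m + 1))
    have h4 := mul_le_mul_of_nonneg_left ih (mul_nonneg hr (norm_nonneg β))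
    have h5 : ‖α‖ * (‖inner ℂ (E (m + 1)) y‖ * r ^ (m + 1)) ≤
        C + r * ‖β‖ * (C / (‖α‖ - r * ‖β‖)) := by
      rw [pow_succ] at *
      linarith
    have h6 : C + r * ‖β‖ * (C / (‖α‖ - r * ‖β‖)) = ‖α‖ * (C / (‖α‖ - r * ‖β‖)) := by
      field_simp
      ring
    rw [h6] at h5
    exact le_of_mul_le_mul_left h5 hα

theorem coeff_moebNum_le (hr : 0 ≤ r) {C : ℝ} {y : H}
    (hy : ∀ m, ‖inner ℂ (E m) y‖ * r ^ m ≤ C) (m : ℕ) :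
    ‖inner ℂ (E m) (α • shift E y + β • y)‖ * r ^ m ≤ (‖α‖ * r + ‖β‖) * C := by
  have hC : 0 ≤ C := le_trans (by positivity) (hy 0)
  have hs : ‖inner ℂ (E m) (shift E y)‖ * r ^ m ≤ r * C := by
    cases m with
    | zero =>
      rw [inner_basis_zero_shift, norm_zero, zero_mul]
      positivity
    | succ m =>
      rw [inner_basis_succ_shift, pow_succ, ← mul_assoc, mul_comm]
      exact mul_le_mul_of_nonneg_left (hy m) hr
  rw [inner_add_right, inner_smul_right, inner_smul_right]
  calc _ ≤ (‖α‖ * ‖inner ℂ (E m) (shift E y)‖ + ‖β‖ * ‖inner ℂ (E m) y‖) * r ^ m := by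
        rw [← norm_mul, ← norm_mul]
        exact mul_le_mul_of_nonneg_right (norm_add_le _ _) (pow_nonneg hr m)
    _ = ‖α‖ * (‖inner ℂ (E m) (shift E y)‖ * r ^ m) + ‖β‖ * (‖inner ℂ (E m) y‖ * r ^ m) := by ring
    _ ≤ ‖α‖ * (r * C) + ‖β‖ * C := by gcongr; exact hy m
    _ = _ := by ring

variable (h : ‖α‖ ^ 2 - ‖β‖ ^ 2 = 1)
include h

theorem coeff_moebIsometry_le (hr : 0 ≤ r) (hd : 0 < ‖α‖ - r * ‖β‖) (k m : ℕ) :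
    ‖inner ℂ (E m) (moebIsometry E h (E k))‖ * r ^ m ≤
      ((‖α‖ * r + ‖β‖) / (‖α‖ - r * ‖β‖)) ^ k / (‖α‖ - r * ‖β‖) := by
  induction k generalizing m with
  | zero =>
    rw [moebIsometry_basis_zero, pow_zero]
    refine coeff_le_of_moebDen E hr hd (fun m => ?_) m
    rw [moebDen_apply, moebDen_vacuum E h]
    rcases eq_or_ne m 0 with rfl | hm
    · rw [inner_self_eq_norm_sq_to_K, E.orthonormal.1 0]
      simp
    · rw [E.orthonormal.2 hm]
      simp
  | succ k ih =>
    rw [← shift_apply_basis, moebIsometry_shift]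
    have hx := moebDen_inverse_apply E h (moebIsometry E h (E k))
    rw [← hx] at ih ⊢
    rw [moeb_apply_moebDen E h]
    refine (coeff_moebNum_le E hr (coeff_le_of_moebDen E hr hd ih) m).trans_eq ?_
    rw [pow_succ]
    ring

omit h in
theorem exists_pow_le_mul_pow {r : ℝ} (hr : 1 < r) (N : ℕ) :
    ∃ B : ℝ, ∀ j : ℕ, (1 + (j : ℝ)) ^ N ≤ B * r ^ j := by
  obtain ⟨B, hB⟩ := (tendsto_pow_const_div_const_pow_of_one_lt N hr).bddAbove_range
  refine ⟨B * r, fun j => ?_⟩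
  have h1 : ((j + 1 : ℕ) : ℝ) ^ N / r ^ (j + 1) ≤ B := hB ⟨j + 1, rfl⟩
  have hr0 : 0 < r := by linarith
  rw [div_le_iff₀ (by positivity)] at h1
  push_cast at h1
  rw [add_comm]
  exact h1.trans_eq (by ring)

/-- The matrix of `moebIsometry` grows at most polynomially in the column index, with respect to
every polynomial weight in the row index. -/
theorem exists_coeff_moebIsometry_le (N : ℕ) : ∃ C : ℝ, 0 ≤ C ∧ ∀ m k : ℕ,
    (1 + (m : ℝ)) ^ N * ‖inner ℂ (E m) (moebIsometry E h (E k))‖ ≤ C * (1 + (k : ℝ)) ^ N := by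
  have hlt := norm_lt_of_su h
  have hβ := norm_nonneg β
  have hsum : 0 < ‖α‖ + ‖β‖ := by linarith
  -- Any r strictly between 1 and |α|/|β| would do; this choice also covers β = 0.
  obtain ⟨r, hr, hd⟩ : ∃ r : ℝ, 1 < r ∧ 0 < ‖α‖ - r * ‖β‖ := by
    refine ⟨2 * ‖α‖ / (‖α‖ + ‖β‖), by rw [lt_div_iff₀ hsum]; linarith, ?_⟩
    rw [sub_pos, div_mul_eq_mul_div, div_lt_iff₀ hsum]
    nlinarith
  have hr0 : 0 < r := by linarith
  set d := ‖α‖ - r * ‖β‖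
  set s := (‖α‖ * r + ‖β‖) / d
  have hs0 : 0 ≤ s := by positivity
  -- A is the slope of the line m = A k past which the growth sᵏ is beaten by rᵐ.
  obtain ⟨A, hA⟩ := pow_unbounded_of_one_lt s hr
  obtain ⟨B, hB⟩ := exists_pow_le_mul_pow hr N
  have hB0 : 0 ≤ B := by
    have := hB 0
    simp only [Nat.cast_zero, add_zero, one_pow, pow_zero, mul_one] at this
    linarith
  -- Truncated subtraction merges the two regimes: up to row A k the exponent is 0 and unitarity
  -- gives the bound 1; beyond it the weighted estimate gives decay.
  have key : ∀ m k : ℕ, ‖inner ℂ (E m) (moebIsometry E h (E k))‖ * r ^ (m - A * k) ≤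
      max 1 (1 / d) := by
    intro m k
    rcases le_total m (A * k) with hm | hm
    · rw [Nat.sub_eq_zero_of_le hm, pow_zero, mul_one]
      refine le_max_of_le_left ((norm_inner_le_norm _ _).trans_eq ?_)
      rw [LinearIsometry.norm_map, E.orthonormal.1, E.orthonormal.1, one_mul]
    · refine le_max_of_le_right ?_
      have h1 := coeff_moebIsometry_le E h hr0.le hd k m
      have h2 : s ^ k ≤ r ^ (A * k) := by
        rw [pow_mul]
        exact pow_le_pow_left₀ hs0 hA.le k
      have h3 : r ^ m = r ^ (m - A * k) * r ^ (A * k) := by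
        rw [← pow_add, Nat.sub_add_cancel hm]
      refine le_of_mul_le_mul_right ?_ (pow_pos hr0 (A * k))
      rw [mul_assoc, ← h3]
      refine h1.trans ?_
      rw [one_div_mul_eq_div]
      gcongr
  refine ⟨(1 + (A : ℝ)) ^ N * B * max 1 (1 / d), by positivity, fun m k => ?_⟩
  have hm : 1 + (m : ℝ) ≤ (1 + (A : ℝ)) * (1 + (k : ℝ)) * (1 + ((m - A * k : ℕ) : ℝ)) := by
    have h1 : (m : ℝ) ≤ (m - A * k : ℕ) + (A : ℝ) * k := by
      exact_mod_cast (by omega : m ≤ m - A * k + A * k)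
    have hj : (0 : ℝ) ≤ (m - A * k : ℕ) := Nat.cast_nonneg _
    have hAk : (0 : ℝ) ≤ (A : ℝ) * k := by positivity
    have hA' : (0 : ℝ) ≤ A := Nat.cast_nonneg _
    have hk' : (0 : ℝ) ≤ k := Nat.cast_nonneg _
    nlinarith [mul_nonneg hAk hj, mul_nonneg hA' hj, mul_nonneg hk' hj]
  calc _ ≤ ((1 + (A : ℝ)) * (1 + (k : ℝ)) * (1 + ((m - A * k : ℕ) : ℝ))) ^ N *
        ‖inner ℂ (E m) (moebIsometry E h (E k))‖ := by gcongr
    _ = (1 + (A : ℝ)) ^ N * (1 + (k : ℝ)) ^ N * ((1 + ((m - A * k : ℕ) : ℝ)) ^ N *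
        ‖inner ℂ (E m) (moebIsometry E h (E k))‖) := by rw [mul_pow, mul_pow]; ring
    _ ≤ (1 + (A : ℝ)) ^ N * (1 + (k : ℝ)) ^ N * (B * r ^ (m - A * k) *
        ‖inner ℂ (E m) (moebIsometry E h (E k))‖) := by gcongr; exact hB _
    _ = (1 + (A : ℝ)) ^ N * (1 + (k : ℝ)) ^ N * (B *
        (‖inner ℂ (E m) (moebIsometry E h (E k))‖ * r ^ (m - A * k))) := by ring
    _ ≤ (1 + (A : ℝ)) ^ N * (1 + (k : ℝ)) ^ N * (B * max 1 (1 / d)) := by gcongr; exact key m k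
    _ = _ := by ring

end Coefficients

/-! ### Operators with polynomially bounded matrices -/

theorem summable_inv_one_add_sq : Summable fun k : ℕ => ((1 + (k : ℝ)) ^ 2)⁻¹ := by
  have h1 := (summable_nat_add_iff 1).2 (Real.summable_one_div_nat_pow.2 one_lt_two)
  refine h1.congr fun k => ?_
  push_cast
  rw [one_div, add_comm]

/-- The sum of the weights `(1 + k)⁻²`. -/
def weightSum : ℝ := ∑' k : ℕ, ((1 + (k : ℝ)) ^ 2)⁻¹

theorem hasSum_weightSum : HasSum (fun k : ℕ => ((1 + (k : ℝ)) ^ 2)⁻¹) weightSum :=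
  summable_inv_one_add_sq.hasSum

theorem weightSum_nonneg : 0 ≤ weightSum := tsum_nonneg fun _ => by positivity

theorem hasSum_weightSum_prod : HasSum
    (fun p : ℕ × ℕ => ((1 + (p.1 : ℝ)) ^ 2)⁻¹ * ((1 + (p.2 : ℝ)) ^ 2)⁻¹)
    (weightSum * weightSum) :=
  hasSum_weightSum.mul hasSum_weightSum (summable_inv_one_add_sq.mul_of_nonneg
    summable_inv_one_add_sq (fun _ => by positivity) (fun _ => by positivity))

theorem le_mul_inv_of_mul_le {w x B : ℝ} (hw : 0 < w) (h : w * x ≤ B) : x ≤ B * w⁻¹ := by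
  rw [← div_eq_mul_inv, le_div_iff₀ hw, mul_comm]
  exact h

theorem norm_le_of_coeff_le (E : HilbertBasis ℕ ℂ H) {x : H} {B : ℝ}
    (hx : ∀ k : ℕ, (1 + (k : ℝ)) ^ 2 * ‖inner ℂ (E k) x‖ ≤ B) : ‖x‖ ≤ B * weightSum := by
  refine (E.hasSum_repr x).norm_le_of_bounded (hasSum_weightSum.mul_left B) fun k => ?_
  rw [HilbertBasis.repr_apply_apply, norm_smul, E.orthonormal.1, mul_one]
  exact le_mul_inv_of_mul_le (by positivity) (hx k)

/-- The matrix of `V` is bounded by polynomials in the column index, with respect to every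
polynomial weight in the row index. -/
def IsPolyBounded (E : HilbertBasis ℕ ℂ H) (V : H →L[ℂ] H) : Prop :=
  ∀ N : ℕ, ∃ C : ℝ, 0 ≤ C ∧ ∀ m k : ℕ,
    (1 + (m : ℝ)) ^ N * ‖inner ℂ (E m) (V (E k))‖ ≤ C * (1 + (k : ℝ)) ^ N

/-- N powers of the decay of x absorb the growth of the columns, and the other two make the sum over
columns converge. The constant is uniform in x, which yields continuity later. -/
theorem IsPolyBounded.exists_coeff_le {E : HilbertBasis ℕ ℂ H} {V : H →L[ℂ] H}
    (hV : IsPolyBounded E V) (N : ℕ) : ∃ C : ℝ, 0 ≤ C ∧ ∀ (x : H) (B : ℝ),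
      (∀ k : ℕ, (1 + (k : ℝ)) ^ (N + 2) * ‖inner ℂ (E k) x‖ ≤ B) →
      ∀ m : ℕ, (1 + (m : ℝ)) ^ N * ‖inner ℂ (E m) (V x)‖ ≤ C * B := by
  obtain ⟨C, hC0, hC⟩ := hV N
  refine ⟨C * weightSum, mul_nonneg hC0 weightSum_nonneg, fun x B hx m => ?_⟩
  have h1 := ((E.hasSum_repr x).mapL V).mapL (innerSL ℂ (E m))
  have h2 := h1.norm_le_of_bounded
    (hasSum_weightSum.mul_left (C * B * ((1 + (m : ℝ)) ^ N)⁻¹)) fun k => ?_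
  · rw [innerSL_apply_apply] at h2
    calc _ ≤ (1 + (m : ℝ)) ^ N * (C * B * ((1 + (m : ℝ)) ^ N)⁻¹ * weightSum) := by gcongr
      _ = _ := by field_simp
  · rw [map_smul, map_smul, innerSL_apply_apply, norm_smul, HilbertBasis.repr_apply_apply]
    have h3 : ‖inner ℂ (E m) (V (E k))‖ ≤ C * (1 + (k : ℝ)) ^ N * ((1 + (m : ℝ)) ^ N)⁻¹ :=
      le_mul_inv_of_mul_le (by positivity) (hC m k)
    have h4 : (1 + (k : ℝ)) ^ N * ‖inner ℂ (E k) x‖ ≤ B * ((1 + (k : ℝ)) ^ 2)⁻¹ := by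
      refine le_mul_inv_of_mul_le (by positivity) ?_
      rw [← mul_assoc, ← pow_add, add_comm 2 N]
      exact hx k
    calc _ ≤ ‖inner ℂ (E k) x‖ * (C * (1 + (k : ℝ)) ^ N * ((1 + (m : ℝ)) ^ N)⁻¹) := by gcongr
      _ = C * ((1 + (m : ℝ)) ^ N)⁻¹ * ((1 + (k : ℝ)) ^ N * ‖inner ℂ (E k) x‖) := by ring
      _ ≤ C * ((1 + (m : ℝ)) ^ N)⁻¹ * (B * ((1 + (k : ℝ)) ^ 2)⁻¹) := by gcongr
      _ = _ := by ring

theorem IsPolyBounded.apply_mem_rapidDecay {E : HilbertBasis ℕ ℂ H} {V : H →L[ℂ] H}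
    (hV : IsPolyBounded E V) {x : H} (hx : x ∈ rapidDecay E) : V x ∈ rapidDecay E := by
  intro N
  obtain ⟨C, -, hC⟩ := hV.exists_coeff_le N
  obtain ⟨B, hB⟩ := hx (N + 2)
  refine ⟨C * B, fun m => ?_⟩
  simp only [HilbertBasis.repr_apply_apply] at hB ⊢
  exact hC x B hB m

theorem norm_inner_weightOp (E : HilbertBasis ℕ ℂ H) (N : ℕ) (x : rapidDecay E) (k : ℕ) :
    ‖inner ℂ (E k) (weightOp E N x)‖ = (1 + (k : ℝ)) ^ N * ‖inner ℂ (E k) (x : H)‖ := by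
  have h1 : E.repr (weightOp E N x) k = (1 + (k : ℂ)) ^ N * E.repr (x : H) k :=
    congrArg (fun y : lp (fun _ : ℕ => ℂ) 2 => y k) (LinearIsometryEquiv.apply_symm_apply E.repr _)
  rw [HilbertBasis.repr_apply_apply, HilbertBasis.repr_apply_apply] at h1
  have h2 : ‖(1 + (k : ℂ))‖ = 1 + (k : ℝ) := by
    rw [← Nat.cast_one, ← Nat.cast_add, Complex.norm_natCast]
    push_cast
    rfl
  rw [h1, norm_mul, norm_pow, h2]

theorem IsPolyBounded.continuous_rapidDecay {E : HilbertBasis ℕ ℂ H} {V : H →L[ℂ] H}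
    (hV : IsPolyBounded E V) :
    @Continuous _ _ (rapidDecayTopology E) (rapidDecayTopology E)
      (fun x : rapidDecay E => (⟨V x, hV.apply_mem_rapidDecay x.2⟩ : rapidDecay E)) := by
  have hws : @WithSeminorms ℂ (rapidDecay E) ℕ _ _ _ (rapidDecaySeminorms E)
      (rapidDecayTopology E) :=
    @WithSeminorms.mk ℂ (rapidDecay E) ℕ _ _ _ (rapidDecaySeminorms E) (rapidDecayTopology E) rfl
  let f : rapidDecay E →ₗ[ℂ] rapidDecay E :=
    V.toLinearMap.restrict fun x hx => hV.apply_mem_rapidDecay hx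
  refine WithSeminorms.continuous_of_isBounded (τ₁₂ := RingHom.id ℂ) hws hws f fun N => ?_
  obtain ⟨C, hC0, hC⟩ := hV.exists_coeff_le (N + 2)
  -- Two orders are lost in summing over columns and two more in bounding the Hilbert norm by
  -- weighted coefficients.
  refine ⟨{N + 4}, ⟨C * weightSum, mul_nonneg hC0 weightSum_nonneg⟩, fun x => ?_⟩
  rw [Finset.sup_singleton]
  change ‖weightOp E N (f x)‖ ≤ C * weightSum * ‖weightOp E (N + 4) x‖
  have h1 := hC x ‖weightOp E (N + 4) x‖ fun k => by
    rw [← norm_inner_weightOp]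
    refine (norm_inner_le_norm _ _).trans_eq ?_
    rw [E.orthonormal.1, one_mul]
  refine (norm_le_of_coeff_le E (B := C * ‖weightOp E (N + 4) x‖) fun m => ?_).trans_eq (by ring)
  rw [norm_inner_weightOp, ← mul_assoc, ← pow_add, add_comm 2 N]
  exact h1 m

/-! ### Smooth compact operators -/

theorem matrixUnit_apply (E : HilbertBasis ℕ ℂ H) (k l : ℕ) (x : H) :
    matrixUnit E k l x = inner ℂ (E l) x • E k := rfl

theorem norm_matrixUnit (E : HilbertBasis ℕ ℂ H) (k l : ℕ) : ‖matrixUnit E k l‖ = 1 := by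
  rw [matrixUnit, InnerProductSpace.norm_rankOne, E.orthonormal.1, E.orthonormal.1, one_mul]

theorem IsRD₂.exists_le_prod {c : ℕ → ℕ → ℂ} (hc : IsRD₂ c) (N : ℕ) : ∃ C : ℝ, ∀ k l : ℕ,
    (1 + (k : ℝ)) ^ N * (1 + (l : ℝ)) ^ N * ‖c k l‖ ≤ C := by
  obtain ⟨C, hC⟩ := hc (N + N)
  refine ⟨C, fun k l => le_trans ?_ (hC k l)⟩
  have hk : (0 : ℝ) ≤ k := Nat.cast_nonneg k
  have hl : (0 : ℝ) ≤ l := Nat.cast_nonneg l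
  rw [pow_add]
  refine mul_le_mul_of_nonneg_right (mul_le_mul (pow_le_pow_left₀ ?_ ?_ N)
    (pow_le_pow_left₀ ?_ ?_ N) ?_ ?_) (norm_nonneg _)
  any_goals positivity
  all_goals linarith

theorem hasSum_coeff_matrixUnit (E : HilbertBasis ℕ ℂ H) (T : H →L[ℂ] H)
    (hT : IsRD₂ fun m n => inner ℂ (E m) (T (E n))) :
    HasSum (fun p : ℕ × ℕ => (inner ℂ (E p.1) (T (E p.2)) : ℂ) • matrixUnit E p.1 p.2) T := by
  obtain ⟨C, hC⟩ := hT.exists_le_prod 2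
  have hs : Summable fun p : ℕ × ℕ =>
      (inner ℂ (E p.1) (T (E p.2)) : ℂ) • matrixUnit E p.1 p.2 := by
    refine Summable.of_norm_bounded (hasSum_weightSum_prod.summable.mul_left C) fun p => ?_
    rw [norm_smul, norm_matrixUnit, mul_one, ← mul_inv]
    exact le_mul_inv_of_mul_le (by positivity) (hC p.1 p.2)
  convert hs.hasSum using 1
  refine clm_ext_basis E fun n => ext_inner_basis E fun m => ?_
  have h1 := (hs.hasSum.mapL (ContinuousLinearMap.apply ℂ H (E n))).mapL (innerSL ℂ (E m))
  refine Eq.trans ?_ ((hasSum_single (f := fun p : ℕ × ℕ => (inner ℂ (E m)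
    (((inner ℂ (E p.1) (T (E p.2)) : ℂ) • matrixUnit E p.1 p.2) (E n)) : ℂ))
    (m, n) fun p hp => ?_).unique h1)
  · change inner ℂ (E m) (T (E n)) = inner ℂ (E m) ((inner ℂ (E m) (T (E n)) : ℂ) •
      matrixUnit E m n (E n))
    rw [matrixUnit_apply, inner_smul_right, inner_smul_right, inner_self_eq_norm_sq_to_K,
      inner_self_eq_norm_sq_to_K, E.orthonormal.1, E.orthonormal.1]
    simp
  · change inner ℂ (E m) ((inner ℂ (E p.1) (T (E p.2)) : ℂ) •
      matrixUnit E p.1 p.2 (E n)) = 0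
    rw [matrixUnit_apply, inner_smul_right, inner_smul_right]
    by_cases h3 : p.2 = n
    · have h4 : m ≠ p.1 := fun h4 => hp (Prod.ext h4.symm h3)
      rw [E.orthonormal.2 h4, mul_zero, mul_zero]
    · rw [E.orthonormal.2 h3, zero_mul, mul_zero]

/-- Since V is unitary, the matrix of V⁻¹ is the conjugate transpose of that of V, so column bounds
for V alone control both factors of V a V⁻¹. -/
theorem IsPolyBounded.conj_mem_smoothCompact {E : HilbertBasis ℕ ℂ H} (V : H ≃ₗᵢ[ℂ] H)
    (hV : IsPolyBounded E (V : H →L[ℂ] H)) {a : H →L[ℂ] H} (ha : a ∈ smoothCompact E) :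
    V.conjStarAlgEquiv a ∈ smoothCompact E := by
  obtain ⟨c, hc, hsum⟩ := ha
  have hentry : ∀ m n : ℕ, HasSum (fun p : ℕ × ℕ => c p.1 p.2 *
      (inner ℂ (V (E p.2)) (E n) * inner ℂ (E m) (V (E p.1))))
      (inner ℂ (E m) (V.conjStarAlgEquiv a (E n))) := by
    intro m n
    have h1 := ((hsum.mapL (ContinuousLinearMap.apply ℂ H (V.symm (E n)))).mapL
      (V : H →L[ℂ] H)).mapL (innerSL ℂ (E m))
    refine HasSum.congr_fun (f := fun p : ℕ × ℕ => inner ℂ (E m)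
      (V ((c p.1 p.2 • matrixUnit E p.1 p.2) (V.symm (E n))))) h1 fun p => ?_
    rw [_root_.smul_apply, matrixUnit_apply, map_smul, map_smul, inner_smul_right,
      inner_smul_right, ← V.inner_map_map (E p.2), V.apply_symm_apply]
  have hRD : IsRD₂ fun m n => inner ℂ (E m) (V.conjStarAlgEquiv a (E n)) := by
    intro N
    obtain ⟨C, hC0, hC⟩ := hV N
    -- In each index, N powers compensate the column growth and two give summability.
    obtain ⟨B, hB⟩ := hc.exists_le_prod (N + 2)
    refine ⟨C * C * B * (weightSum * weightSum), fun m n => ?_⟩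
    have hm : (0 : ℝ) < (1 + (m : ℝ)) ^ N := by positivity
    have hn : (0 : ℝ) < (1 + (n : ℝ)) ^ N := by positivity
    have h1 := (hentry m n).norm_le_of_bounded (hasSum_weightSum_prod.mul_left
      (C * C * B * (((1 + (m : ℝ)) ^ N)⁻¹ * ((1 + (n : ℝ)) ^ N)⁻¹))) fun p => ?_
    · calc _ ≤ ((1 + (m : ℝ)) * (1 + (n : ℝ))) ^ N *
            ‖inner ℂ (E m) (V.conjStarAlgEquiv a (E n))‖ := by
            gcongr
            nlinarith [mul_nonneg (Nat.cast_nonneg (α := ℝ) m) (Nat.cast_nonneg (α := ℝ) n)]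
        _ ≤ ((1 + (m : ℝ)) * (1 + (n : ℝ))) ^ N * (C * C * B * (((1 + (m : ℝ)) ^ N)⁻¹ *
            ((1 + (n : ℝ)) ^ N)⁻¹) * (weightSum * weightSum)) := by gcongr
        _ = _ := by rw [mul_pow]; field_simp
    · have h2 : ‖inner ℂ (E m) (V (E p.1))‖ ≤
          C * (1 + (p.1 : ℝ)) ^ N * ((1 + (m : ℝ)) ^ N)⁻¹ := le_mul_inv_of_mul_le hm (hC m p.1)
      have h3 : ‖inner ℂ (V (E p.2)) (E n)‖ ≤
          C * (1 + (p.2 : ℝ)) ^ N * ((1 + (n : ℝ)) ^ N)⁻¹ := by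
        rw [norm_inner_symm]
        exact le_mul_inv_of_mul_le hn (hC n p.2)
      have h4 : (1 + (p.1 : ℝ)) ^ N * (1 + (p.2 : ℝ)) ^ N * ‖c p.1 p.2‖ ≤
          B * (((1 + (p.1 : ℝ)) ^ 2)⁻¹ * ((1 + (p.2 : ℝ)) ^ 2)⁻¹) := by
        rw [← mul_inv]
        refine le_mul_inv_of_mul_le (by positivity) ((hB p.1 p.2).trans_eq' ?_)
        ring
      rw [norm_mul, norm_mul]
      calc _ ≤ ‖c p.1 p.2‖ * (C * (1 + (p.2 : ℝ)) ^ N * ((1 + (n : ℝ)) ^ N)⁻¹ *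
            (C * (1 + (p.1 : ℝ)) ^ N * ((1 + (m : ℝ)) ^ N)⁻¹)) := by gcongr
        _ = C * C * (((1 + (m : ℝ)) ^ N)⁻¹ * ((1 + (n : ℝ)) ^ N)⁻¹) *
            ((1 + (p.1 : ℝ)) ^ N * (1 + (p.2 : ℝ)) ^ N * ‖c p.1 p.2‖) := by ring
        _ ≤ C * C * (((1 + (m : ℝ)) ^ N)⁻¹ * ((1 + (n : ℝ)) ^ N)⁻¹) *
            (B * (((1 + (p.1 : ℝ)) ^ 2)⁻¹ * ((1 + (p.2 : ℝ)) ^ 2)⁻¹)) := by gcongr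
        _ = _ := by ring
  exact ⟨_, hRD, hasSum_coeff_matrixUnit E _ hRD⟩

end SmoothToeplitz

end

theorem mainTheorem9 {H : Type*} [NormedAddCommGroup H] [InnerProductSpace ℂ H] [CompleteSpace H]
    (E : HilbertBasis ℕ ℂ H) (g : Matrix (Fin 2) (Fin 2) ℂ) (hg : g ∈ SmoothToeplitz.SU11) :
    -- `W_g` is well defined, and `U ↦ W_g` extends uniquely to an automorphism `ρ_g` of `𝒯`
    IsUnit (SmoothToeplitz.mobiusDenom E g) ∧
    ∃ ρ : SmoothToeplitz.toeplitzAlgebra E ≃⋆ₐ[ℂ] SmoothToeplitz.toeplitzAlgebra E,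
      ρ (SmoothToeplitz.shiftT E) = SmoothToeplitz.mobiusShift E g ∧
      (∀ ρ' : SmoothToeplitz.toeplitzAlgebra E ≃⋆ₐ[ℂ] SmoothToeplitz.toeplitzAlgebra E,
        ρ' (SmoothToeplitz.shiftT E) = SmoothToeplitz.mobiusShift E g → ρ' = ρ) ∧
      -- `ρ_g` preserves the smooth Toeplitz algebra
      ρ '' SmoothToeplitz.smoothToeplitz E ⊆ SmoothToeplitz.smoothToeplitz E ∧
      -- `ρ_g` is implemented by the unitary `E k ↦ W_g ^ k F₀`, which maps `S_ℰ` continuously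
      -- into itself
      ∃ F₀ : H, HasSum (fun k : ℕ => ((-star (g 0 1)) ^ k / (star (g 0 0)) ^ (k + 1)) • E k) F₀ ∧
        ∃ V : H ≃ₗᵢ[ℂ] H,
          (∀ k : ℕ, V (E k) =
            (((SmoothToeplitz.mobiusShift E g) ^ k : SmoothToeplitz.toeplitzAlgebra E) :
              H →L[ℂ] H) F₀) ∧
          (∀ (a : SmoothToeplitz.toeplitzAlgebra E) (x : H),
            (ρ a : H →L[ℂ] H) x = V ((a : H →L[ℂ] H) (V.symm x))) ∧
          ∃ hV : ∀ x ∈ SmoothToeplitz.rapidDecay E, V x ∈ SmoothToeplitz.rapidDecay E,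
            @Continuous _ _ (SmoothToeplitz.rapidDecayTopology E) (SmoothToeplitz.rapidDecayTopology E)
              (fun x : SmoothToeplitz.rapidDecay E =>
                (⟨V x, hV x x.2⟩ : SmoothToeplitz.rapidDecay E)) := by
  open SmoothToeplitz in
  obtain ⟨α, β, rfl, h⟩ := hg
  have hpoly : IsPolyBounded E (moebUnitary E h : H →L[ℂ] H) := exists_coeff_moebIsometry_le E h
  refine ⟨isUnit_moebDen E h, moebAut E h, moebAut_shiftT E h, fun ρ' hρ' =>
    starAlgEquiv_ext_shiftT E (hρ'.trans (moebAut_shiftT E h).symm), ?_, vacuum E α β,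
    hasSum_vacuum E h, moebUnitary E h, moebIsometry_basis E h, moebAut_apply E h,
    fun x hx => hpoly.apply_mem_rapidDecay hx, hpoly.continuous_rapidDecay⟩
  rintro _ ⟨a, ⟨f, hf, c, hc, hac⟩, rfl⟩
  -- The image of T(f) + c is T(f ∘ Φ) + V c V⁻¹, already in the required form.
  refine ⟨_, isSmoothOnCircle_comp_circleMoeb (norm_lt_of_su h) hf, _,
    hpoly.conj_mem_smoothCompact _ hc, ?_⟩
  rw [← conj_toeplitzOp, ← map_add, ← hac]
  rfl
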